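/- Let $d \ge 2$ and $n \ge 1$ be integers and let $\sigma > 0$. Let $\mathcal{P} = \{\mathsf{N}(\theta, \sigma^2 I_{d\times d}) \mid \theta \in \mathbb{R}^d\}$ be the $d$-dimensional normal location family, and for $P \in \mathcal{P}$ let $\theta(P) \in \mathbb{R}^d$ denote the mean of $P$. Define the minimax risk in squared Euclidean norm for samples of size $n$ by \[ \mathfrak{M}_n(\theta(\mathcal{P}), \|\cdot\|_2^2) := \inf_{\widehat{\theta}} \, \sup_{P \in \mathcal{P}} \mathbb{E}_P\left[\|\widehat{\theta}(X_1, \ldots, X_n) - \theta(P)\|_2^2\right] \in [0,\infty], \] where $X_1, \ldots, X_n$ are drawn i.i.d. from $P$ and the infimum ranges over all measurable functions $\widehat{\theta} : (\mathbb{R}^d)^n \to \mathbb{R}^d$. Then \[ \mathfrak{M}_n(\theta(\mathcal{P}), \|\cdot\|_2^2) \ge \frac{(d-1)^2 \log 2}{4 d^2} \cdot \frac{\sigma^2 d}{n}. \] -/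

import Mathlib

open MeasureTheory ProbabilityTheory
open scoped NNReal ENNReal

noncomputable section

/-- The risk `𝔼_P [Φ (ρ (est X₁ⁿ, θ P))]` of the estimator `est`, where `X₁ⁿ = (X₁, …, Xₙ)` is an
i.i.d. sample from `P`. It takes values in `[0, ∞]`. -/
def estimatorRisk {X Θ : Type*} [MeasurableSpace X]
    (θ : ProbabilityMeasure X → Θ) (Φ : ℝ≥0 → ℝ≥0) (ρ : Θ → Θ → ℝ≥0) (n : ℕ)
    (est : (Fin n → X) → Θ) (P : ProbabilityMeasure X) : ℝ≥0∞ :=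
  ∫⁻ x, (Φ (ρ (est x) (θ P)) : ℝ≥0∞) ∂(Measure.pi (fun _ : Fin n => (P : Measure X)))

/-- The minimax risk `𝔐ₙ(θ(F), Φ ∘ ρ)`: the infimum, over all measurable estimators of the
sample of size `n`, of the worst-case risk over the family `F`. -/
def minimaxRiskIID {X Θ : Type*} [MeasurableSpace X] [MeasurableSpace Θ]
    (F : Set (ProbabilityMeasure X)) (θ : ProbabilityMeasure X → Θ)
    (Φ : ℝ≥0 → ℝ≥0) (ρ : Θ → Θ → ℝ≥0) (n : ℕ) : ℝ≥0∞ :=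
  ⨅ (est : (Fin n → X) → Θ) (_ : Measurable est), ⨆ P ∈ F, estimatorRisk θ Φ ρ n est P

/-- The normal location family `{N(θ, σ² I) | θ ∈ ℝᵈ}`. -/
def normalLocationFamily (d : ℕ) (σ : ℝ) :
    Set (ProbabilityMeasure (EuclideanSpace ℝ (Fin d))) :=
  {P | ∃ θ : EuclideanSpace ℝ (Fin d),
    (P : Measure (EuclideanSpace ℝ (Fin d))) =
      multivariateGaussian θ (σ ^ 2 • (1 : Matrix (Fin d) (Fin d) ℝ))}

/-- The mean of a distribution on `ℝᵈ` (meaningful for distributions with a first moment, such as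
all members of the normal location family). -/
def meanParameter (d : ℕ) (P : ProbabilityMeasure (EuclideanSpace ℝ (Fin d))) :
    EuclideanSpace ℝ (Fin d) :=
  ∫ x, x ∂(P : Measure (EuclideanSpace ℝ (Fin d)))

end

open scoped RealInnerProductSpace

/-! This is an Assouad-type argument. The worst-case risk dominates the average risk over the
vertices of the cube `{±a}^d`, and squared error splits over coordinates, so each coordinate reduces
to a test between the two ends of a cube edge. If `p`, `q`, `m` are the likelihood ratios at the
ends and the midpoint, then `p * q = c² m²` with `c² = exp (-n a² / σ²)`. An elementary inequality
turns this into a bound on the two-point risk (`two_point_sq_error_lower_bound`). Summing over edges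
and coordinates and taking `a = σ / √n` gives `e⁻¹ σ² d / n`, which is more than claimed. -/

/-! ### Densities of product and Gaussian measures -/

lemma lintegral_pi_prod_eq_prod {ι : Type*} [Fintype ι] {X : ι → Type*}
    [∀ i, MeasurableSpace (X i)] (μ : ∀ i, Measure (X i)) [∀ i, IsProbabilityMeasure (μ i)]
    (f : ∀ i, X i → ℝ≥0∞) (hf : ∀ i, Measurable (f i)) :
    ∫⁻ x, ∏ i, f i (x i) ∂Measure.pi μ = ∏ i, ∫⁻ y, f i y ∂μ i := by
  have hindep : iIndepFun (fun i (x : ∀ i, X i) => f i (x i)) (Measure.pi μ) :=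
    iIndepFun_pi (X := f) fun i => (hf i).aemeasurable
  have h := lintegral_prod_eq_prod_lintegral_of_indepFun Finset.univ _ hindep
    fun i => (hf i).comp (measurable_pi_apply i)
  rw [h]
  refine Finset.prod_congr rfl fun i _ => ?_
  exact (measurePreserving_eval μ i).lintegral_comp (hf i)

lemma pi_eq_withDensity_prod {ι : Type*} [Fintype ι] {X : ι → Type*}
    [∀ i, MeasurableSpace (X i)] (μ ν : ∀ i, Measure (X i)) [∀ i, IsProbabilityMeasure (μ i)]
    [∀ i, SigmaFinite (ν i)]
    (f : ∀ i, X i → ℝ≥0∞) (hf : ∀ i, Measurable (f i)) (hν : ∀ i, ν i = (μ i).withDensity (f i)) :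
    Measure.pi ν = (Measure.pi μ).withDensity fun x => ∏ i, f i (x i) := by
  refine Measure.pi_eq fun s hs => ?_
  rw [withDensity_apply _ (MeasurableSet.univ_pi hs), ← lintegral_indicator (.univ_pi hs)]
  have h : (Set.univ.pi s).indicator (fun x : ∀ i, X i => ∏ i, f i (x i)) =
      fun x => ∏ i, (s i).indicator (f i) (x i) := by
    classical
    ext x
    by_cases hx : x ∈ Set.univ.pi s
    · rw [Set.indicator_of_mem hx]
      exact Finset.prod_congr rfl fun i _ => (Set.indicator_of_mem (hx i trivial) _).symm
    · rw [Set.indicator_of_notMem hx]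
      simp only [Set.mem_pi, Set.mem_univ, true_imp_iff, not_forall] at hx
      obtain ⟨i, hi⟩ := hx
      exact (Finset.prod_eq_zero (Finset.mem_univ i) (Set.indicator_of_notMem hi _)).symm
  rw [h, lintegral_pi_prod_eq_prod μ _ fun i => (hf i).indicator (hs i)]
  refine Finset.prod_congr rfl fun i _ => ?_
  rw [lintegral_indicator (hs i), hν, withDensity_apply _ (hs i)]

lemma gaussianReal_eq_withDensity_gaussianReal_zero (a : ℝ) {v : ℝ≥0} (hv : v ≠ 0) :
    gaussianReal a v = (gaussianReal 0 v).withDensity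
      fun x => ENNReal.ofReal (Real.exp (a * x / v - a ^ 2 / (2 * v))) := by
  rw [gaussianReal_of_var_ne_zero _ hv, gaussianReal_of_var_ne_zero _ hv,
    ← withDensity_mul _ (by fun_prop) (by fun_prop)]
  congr 1
  ext x
  have hv' : (v : ℝ) ≠ 0 := by exact_mod_cast hv
  simp only [Pi.mul_apply, gaussianPDF]
  rw [← ENNReal.ofReal_mul (gaussianPDFReal_nonneg _ _ _), gaussianPDFReal, gaussianPDFReal,
    mul_assoc (√_)⁻¹, ← Real.exp_add]
  congr 3
  field_simp
  ring

lemma multivariateGaussian_smul_one_eq_map_pi {ι : Type*} [Fintype ι] [DecidableEq ι]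
    (θ : EuclideanSpace ℝ ι) (v : ℝ≥0) :
    multivariateGaussian θ ((v : ℝ) • (1 : Matrix ι ι ℝ)) =
      (Measure.pi fun i => gaussianReal (θ i) v).map (WithLp.toLp 2) := by
  have hS : ((v : ℝ) • (1 : Matrix ι ι ℝ)).PosSemidef := Matrix.PosSemidef.one.smul v.2
  apply Measure.ext_of_charFun
  ext t
  rw [charFun_multivariateGaussian hS, charFun_pi]
  simp_rw [charFun_gaussianReal, ← Complex.exp_sum]
  congr 1
  simp only [PiLp.inner_apply, Finset.sum_sub_distrib, Matrix.smul_mulVec, Matrix.one_mulVec,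
    dotProduct, Pi.smul_apply, smul_eq_mul]
  push_cast
  rw [Finset.sum_mul, Finset.sum_div]
  congr 1
  · refine Finset.sum_congr rfl fun i _ => ?_
    simp
    ring
  · refine Finset.sum_congr rfl fun i _ => ?_
    ring

lemma multivariateGaussian_smul_one_eq_withDensity {ι : Type*} [Fintype ι] [DecidableEq ι]
    (θ : EuclideanSpace ℝ ι) {v : ℝ≥0} (hv : v ≠ 0) :
    multivariateGaussian θ ((v : ℝ) • (1 : Matrix ι ι ℝ)) =
      (multivariateGaussian 0 ((v : ℝ) • (1 : Matrix ι ι ℝ))).withDensity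
        fun y => ENNReal.ofReal (Real.exp (⟪θ, y⟫ / v - ‖θ‖ ^ 2 / (2 * v))) := by
  rw [multivariateGaussian_smul_one_eq_map_pi, multivariateGaussian_smul_one_eq_map_pi,
    pi_eq_withDensity_prod (fun _ => gaussianReal 0 v) (fun i => gaussianReal (θ i) v) _
      (fun i => by fun_prop) fun i => gaussianReal_eq_withDensity_gaussianReal_zero (θ i) hv]
  ext s hs
  have hm : Measurable (WithLp.toLp 2 : (ι → ℝ) → EuclideanSpace ℝ ι) := by fun_prop
  rw [Measure.map_apply hm hs, withDensity_apply _ (hm hs), withDensity_apply _ hs,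
    setLIntegral_map hs (by fun_prop) hm]
  refine lintegral_congr fun x => ?_
  rw [← ENNReal.ofReal_prod_of_nonneg fun i _ => (Real.exp_pos _).le, ← Real.exp_sum,
    EuclideanSpace.real_norm_sq_eq, PiLp.inner_apply, Finset.sum_div, Finset.sum_div,
    ← Finset.sum_sub_distrib]
  simp [mul_comm]

/-- The likelihood ratio of a sample from `N(θ, v I)` with respect to `N(0, v I)`. -/
noncomputable def gaussianLikelihoodRatio {E : Type*} [NormedAddCommGroup E] [InnerProductSpace ℝ E]
    {n : ℕ} (v : ℝ) (θ : E) (x : Fin n → E) : ℝ :=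
  Real.exp (∑ i, (⟪θ, x i⟫ / v - ‖θ‖ ^ 2 / (2 * v)))

lemma gaussianLikelihoodRatio_pos {E : Type*} [NormedAddCommGroup E] [InnerProductSpace ℝ E]
    {n : ℕ} (v : ℝ) (θ : E) (x : Fin n → E) : 0 < gaussianLikelihoodRatio v θ x :=
  Real.exp_pos _

/-- The log-likelihood is affine in `θ` apart from `-n ‖θ‖² / (2v)`, so by the parallelogram law the
discrepancy does not depend on the sample. -/
lemma gaussianLikelihoodRatio_add_mul_sub {E : Type*} [NormedAddCommGroup E]
    [InnerProductSpace ℝ E] {n : ℕ} (v : ℝ) (m h : E) (x : Fin n → E) :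
    gaussianLikelihoodRatio v (m + h) x * gaussianLikelihoodRatio v (m - h) x =
      Real.exp (-(n * ‖h‖ ^ 2 / v)) * gaussianLikelihoodRatio v m x ^ 2 := by
  unfold gaussianLikelihoodRatio
  rw [← Real.exp_add, ← Real.exp_nat_mul, ← Real.exp_add, ← Finset.sum_add_distrib,
    Finset.mul_sum]
  have hc : -(n * ‖h‖ ^ 2 / v) = ∑ _i : Fin n, -(‖h‖ ^ 2 / v) := by simp; ring
  rw [hc, ← Finset.sum_add_distrib]
  congr 1
  refine Finset.sum_congr rfl fun i _ => ?_
  have hp := parallelogram_law_with_norm ℝ m h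
  rw [inner_add_left, inner_sub_left]
  have h1 : ‖m + h‖ ^ 2 = 2 * (‖m‖ ^ 2 + ‖h‖ ^ 2) - ‖m - h‖ ^ 2 := by linarith
  rw [h1]
  push_cast
  -- At `v = 0` division by zero makes every exponent vanish.
  rcases eq_or_ne v 0 with rfl | hv
  · simp
  · field_simp
    ring

lemma pi_multivariateGaussian_eq_withDensity {ι : Type*} [Fintype ι] [DecidableEq ι] (n : ℕ)
    (θ : EuclideanSpace ℝ ι) {v : ℝ≥0} (hv : v ≠ 0) :
    Measure.pi (fun _ : Fin n => multivariateGaussian θ ((v : ℝ) • (1 : Matrix ι ι ℝ))) =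
      (Measure.pi fun _ : Fin n =>
        multivariateGaussian 0 ((v : ℝ) • (1 : Matrix ι ι ℝ))).withDensity
        fun x => ENNReal.ofReal (gaussianLikelihoodRatio v θ x) := by
  rw [pi_eq_withDensity_prod _ _ _ (fun i => by fun_prop)
    fun i => multivariateGaussian_smul_one_eq_withDensity θ hv]
  congr 1
  ext x
  rw [gaussianLikelihoodRatio, Real.exp_sum,
    ENNReal.ofReal_prod_of_nonneg fun i _ => (Real.exp_pos _).le]

/-! ### Two-point bound -/

lemma two_point_weighted_sq_error_le {p q m c a t : ℝ} (hp : 0 < p) (hq : 0 < q)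
    (h : p * q = c ^ 2 * m ^ 2) :
    4 * (a ^ 2 * c ^ 2) * m ≤ p * (t - a) ^ 2 + q * (t + a) ^ 2 + a ^ 2 * c ^ 2 * (p + q) := by
  -- After multiplication by `p + q`, the two sides differ by exactly the sum of the two squares
  -- below.
  refine le_of_mul_le_mul_left ?_ (add_pos hp hq)
  nlinarith [sq_nonneg (p * (t - a) + q * (t + a)), sq_nonneg (a * c * (2 * m - (p + q))),
    congrArg (fun z => a ^ 2 * z) h]

/-- The two-point lower bound for squared error, in terms of the likelihood ratios `p`, `q` of the
two hypotheses and `m` of a midpoint, all relative to `μ`. -/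
lemma two_point_sq_error_lower_bound {α : Type*} [MeasurableSpace α] {μ : Measure α}
    {p q m T : α → ℝ} {a c : ℝ} (hp : ∀ x, 0 < p x) (hq : ∀ x, 0 < q x)
    (hpm : Measurable p) (hqm : Measurable q) (hT : Measurable T)
    (hp1 : ∫⁻ x, ENNReal.ofReal (p x) ∂μ = 1) (hq1 : ∫⁻ x, ENNReal.ofReal (q x) ∂μ = 1)
    (hm1 : ∫⁻ x, ENNReal.ofReal (m x) ∂μ = 1) (h : ∀ x, p x * q x = c ^ 2 * m x ^ 2) :
    ENNReal.ofReal (2 * (a ^ 2 * c ^ 2)) ≤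
      ∫⁻ x, ENNReal.ofReal (p x) * ENNReal.ofReal ((T x - a) ^ 2) ∂μ +
        ∫⁻ x, ENNReal.ofReal (q x) * ENNReal.ofReal ((T x + a) ^ 2) ∂μ := by
  set k := a ^ 2 * c ^ 2 with hk
  have hk0 : 0 ≤ k := by positivity
  -- The term `k (p + q)` has finite integral `2 * k`, which is cancelled at the end.
  have key : ENNReal.ofReal (4 * k) ≤
      (∫⁻ x, ENNReal.ofReal (p x) * ENNReal.ofReal ((T x - a) ^ 2) ∂μ +
        ∫⁻ x, ENNReal.ofReal (q x) * ENNReal.ofReal ((T x + a) ^ 2) ∂μ) +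
        ENNReal.ofReal (2 * k) := by
    calc ENNReal.ofReal (4 * k)
        = ∫⁻ x, ENNReal.ofReal (4 * k) * ENNReal.ofReal (m x) ∂μ := by
          rw [lintegral_const_mul' _ _ ENNReal.ofReal_ne_top, hm1, mul_one]
      _ ≤ ∫⁻ x, (ENNReal.ofReal (p x) * ENNReal.ofReal ((T x - a) ^ 2) +
            ENNReal.ofReal (q x) * ENNReal.ofReal ((T x + a) ^ 2)) +
            ENNReal.ofReal k * (ENNReal.ofReal (p x) + ENNReal.ofReal (q x)) ∂μ := by
          refine lintegral_mono fun x => ?_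
          have := (hp x).le
          have := (hq x).le
          rw [← ENNReal.ofReal_mul (by positivity), ← ENNReal.ofReal_mul (by positivity),
            ← ENNReal.ofReal_mul (by positivity), ← ENNReal.ofReal_add (by positivity)
            (by positivity), ← ENNReal.ofReal_add (by positivity) (by positivity),
            ← ENNReal.ofReal_mul (by positivity), ← ENNReal.ofReal_add (by positivity)
            (by positivity)]
          exact ENNReal.ofReal_le_ofReal (two_point_weighted_sq_error_le (hp x) (hq x) (h x))
      _ = _ := by
          rw [lintegral_add_left (by fun_prop), lintegral_add_left (by fun_prop),
            lintegral_const_mul' _ _ ENNReal.ofReal_ne_top, lintegral_add_left (by fun_prop),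
            hp1, hq1, one_add_one_eq_two, mul_comm 2 k, ENNReal.ofReal_mul hk0]
          simp
  have h4 : ENNReal.ofReal (4 * k) = ENNReal.ofReal (2 * k) + ENNReal.ofReal (2 * k) := by
    rw [← ENNReal.ofReal_add (by positivity) (by positivity)]
    ring_nf
  rw [h4] at key
  exact (ENNReal.add_le_add_iff_right ENNReal.ofReal_ne_top).1 key

/-! ### Averaging over the hypercube -/

/-- The vertex `(±a, …, ±a)` of the hypercube with sign pattern `s`. -/
noncomputable def hypercubeVertex {ι : Type*} (a : ℝ) (s : ι → Bool) : EuclideanSpace ℝ ι :=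
  WithLp.toLp 2 fun j => if s j then a else -a

/-- The mean squared error in coordinate `j` of the estimator `est` of the mean of `N(θ, v I)`. -/
noncomputable def coordinateRisk {ι : Type*} [Fintype ι] [DecidableEq ι] {n : ℕ} (v : ℝ)
    (est : (Fin n → EuclideanSpace ℝ ι) → EuclideanSpace ℝ ι) (θ : EuclideanSpace ℝ ι)
    (j : ι) : ℝ≥0∞ :=
  ∫⁻ x, ENNReal.ofReal ((est x j - θ j) ^ 2)
    ∂Measure.pi fun _ : Fin n => multivariateGaussian θ (v • (1 : Matrix ι ι ℝ))

lemma lintegral_gaussianLikelihoodRatio {ι : Type*} [Fintype ι] [DecidableEq ι] (n : ℕ)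
    (θ : EuclideanSpace ℝ ι) {v : ℝ≥0} (hv : v ≠ 0) :
    ∫⁻ x, ENNReal.ofReal (gaussianLikelihoodRatio v θ x) ∂(Measure.pi fun _ : Fin n =>
      multivariateGaussian 0 ((v : ℝ) • (1 : Matrix ι ι ℝ))) = 1 := by
  rw [← setLIntegral_univ, ← withDensity_apply _ .univ,
    ← pi_multivariateGaussian_eq_withDensity n θ hv, measure_univ]

lemma measurable_gaussianLikelihoodRatio {ι : Type*} [Fintype ι] {n : ℕ} (v : ℝ)
    (θ : EuclideanSpace ℝ ι) :
    Measurable (gaussianLikelihoodRatio v θ : (Fin n → EuclideanSpace ℝ ι) → ℝ) := by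
  unfold gaussianLikelihoodRatio
  fun_prop

lemma coordinateRisk_eq {ι : Type*} [Fintype ι] [DecidableEq ι] {n : ℕ} {v : ℝ≥0} (hv : v ≠ 0)
    {est : (Fin n → EuclideanSpace ℝ ι) → EuclideanSpace ℝ ι} (hest : Measurable est)
    (θ : EuclideanSpace ℝ ι) (j : ι) :
    coordinateRisk v est θ j =
      ∫⁻ x, ENNReal.ofReal (gaussianLikelihoodRatio v θ x) *
        ENNReal.ofReal ((est x j - θ j) ^ 2) ∂(Measure.pi fun _ : Fin n =>
          multivariateGaussian 0 ((v : ℝ) • (1 : Matrix ι ι ℝ))) := by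
  have := measurable_gaussianLikelihoodRatio (n := n) v θ
  rw [coordinateRisk, pi_multivariateGaussian_eq_withDensity n θ hv,
    lintegral_withDensity_eq_lintegral_mul _ (by fun_prop) (by fun_prop)]
  rfl

lemma coordinateRisk_add_coordinateRisk_ge {ι : Type*} [Fintype ι] [DecidableEq ι] {n : ℕ}
    {v : ℝ≥0} (hv : v ≠ 0) {est : (Fin n → EuclideanSpace ℝ ι) → EuclideanSpace ℝ ι}
    (hest : Measurable est) (θ : EuclideanSpace ℝ ι) (j : ι) (hθ : θ j = 0) (a : ℝ) :
    ENNReal.ofReal (2 * (a ^ 2 * Real.exp (-(n * a ^ 2 / v)))) ≤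
      coordinateRisk v est (θ + EuclideanSpace.single j a) j +
        coordinateRisk v est (θ - EuclideanSpace.single j a) j := by
  rw [coordinateRisk_eq hv hest, coordinateRisk_eq hv hest]
  have hc : Real.exp (-(n * a ^ 2 / v)) = Real.exp (-(n * a ^ 2 / v) / 2) ^ 2 := by
    rw [← Real.exp_nat_mul]
    congr 1
    push_cast
    ring
  have h := two_point_sq_error_lower_bound (T := fun x => est x j) (a := a)
    (c := Real.exp (-(n * a ^ 2 / v) / 2))
    (gaussianLikelihoodRatio_pos _ _) (gaussianLikelihoodRatio_pos _ _)
    (measurable_gaussianLikelihoodRatio (n := n) v (θ + EuclideanSpace.single j a))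
    (measurable_gaussianLikelihoodRatio (n := n) v (θ - EuclideanSpace.single j a))
    (by fun_prop) (lintegral_gaussianLikelihoodRatio n _ hv)
    (lintegral_gaussianLikelihoodRatio n _ hv) (lintegral_gaussianLikelihoodRatio n θ hv)
    (fun x => by
      rw [gaussianLikelihoodRatio_add_mul_sub, PiLp.norm_single, Real.norm_eq_abs,
        sq_abs, hc])
  rw [hc]
  simpa [hθ] using h

lemma coordinateRisk_hypercubeVertex_add_flip_ge {ι : Type*} [Fintype ι] [DecidableEq ι] {n : ℕ}
    {v : ℝ≥0} (hv : v ≠ 0) {est : (Fin n → EuclideanSpace ℝ ι) → EuclideanSpace ℝ ι}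
    (hest : Measurable est) (a : ℝ) (s : ι → Bool) (j : ι) :
    ENNReal.ofReal (2 * (a ^ 2 * Real.exp (-(n * a ^ 2 / v)))) ≤
      coordinateRisk v est (hypercubeVertex a s) j +
        coordinateRisk v est (hypercubeVertex a (Function.update s j (!s j))) j := by
  -- The midpoint of the edge in direction `j`; the signed half-length `b` below makes `s` always
  -- the plus end.
  set θ : EuclideanSpace ℝ ι :=
    WithLp.toLp 2 fun i => if i = j then 0 else if s i then a else -a with hθ
  have h := coordinateRisk_add_coordinateRisk_ge hv hest θ j (by simp [hθ])
  have hv1 (b : ℝ) (hb : b = if s j then a else -a) :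
      hypercubeVertex a s = θ + EuclideanSpace.single j b := by
    ext i
    by_cases hi : i = j
    · subst hi; simp [hypercubeVertex, hθ, hb]
    · simp [hypercubeVertex, hθ, hi]
  have hv2 (b : ℝ) (hb : b = if s j then a else -a) :
      hypercubeVertex a (Function.update s j (!s j)) = θ - EuclideanSpace.single j b := by
    ext i
    by_cases hi : i = j
    · subst hi
      by_cases hs : s i <;> simp [hypercubeVertex, hθ, hb, hs]
    · simp [hypercubeVertex, hθ, hi]
  rw [hv1 _ rfl, hv2 _ rfl]
  have hsq : (if s j then a else -a) ^ 2 = a ^ 2 := by split_ifs <;> simp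
  rw [← hsq]
  exact h _

lemma sum_update_not {ι : Type*} [Fintype ι] [DecidableEq ι] {M : Type*} [AddCommMonoid M]
    (f : (ι → Bool) → M) (j : ι) :
    ∑ s, f (Function.update s j (!s j)) = ∑ s, f s := by
  have hinv : Function.Involutive fun s : ι → Bool => Function.update s j (!s j) := by
    intro s
    dsimp only
    rw [Function.update_self, Function.update_idem, Bool.not_not, Function.update_eq_self]
  exact Equiv.sum_comp hinv.toPerm f

/-- Flipping bit `j` permutes the vertices, so summing the edge bound counts each risk twice. -/
lemma sum_coordinateRisk_hypercubeVertex_ge {ι : Type*} [Fintype ι] [DecidableEq ι] {n : ℕ}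
    {v : ℝ≥0} (hv : v ≠ 0) {est : (Fin n → EuclideanSpace ℝ ι) → EuclideanSpace ℝ ι}
    (hest : Measurable est) (a : ℝ) (j : ι) :
    Fintype.card (ι → Bool) * ENNReal.ofReal (a ^ 2 * Real.exp (-(n * a ^ 2 / v))) ≤
      ∑ s, coordinateRisk v est (hypercubeVertex a s) j := by
  have h : ∑ _s : ι → Bool, ENNReal.ofReal (2 * (a ^ 2 * Real.exp (-(n * a ^ 2 / v)))) ≤ _ :=
    Finset.sum_le_sum fun s _ => coordinateRisk_hypercubeVertex_add_flip_ge hv hest a s j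
  rw [Finset.sum_add_distrib,
    sum_update_not (fun s => coordinateRisk v est (hypercubeVertex a s) j), ← two_mul,
    ENNReal.ofReal_mul zero_le_two, Finset.sum_const, Finset.card_univ, nsmul_eq_mul,
    ENNReal.ofReal_ofNat, mul_left_comm] at h
  exact (ENNReal.mul_le_mul_iff_right two_ne_zero ENNReal.ofNat_ne_top).1 h

/-- Lower bound for the worst-case risk over the vertices of a hypercube. -/
lemma hypercube_risk_lower_bound {ι : Type*} [Fintype ι] [DecidableEq ι] {n : ℕ}
    {v : ℝ≥0} (hv : v ≠ 0) {est : (Fin n → EuclideanSpace ℝ ι) → EuclideanSpace ℝ ι}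
    (hest : Measurable est) (a : ℝ) (M : ℝ≥0∞)
    (hM : ∀ θ, ∑ j, coordinateRisk v est θ j ≤ M) :
    Fintype.card ι * ENNReal.ofReal (a ^ 2 * Real.exp (-(n * a ^ 2 / v))) ≤ M := by
  have h1 : ∑ _j : ι, (Fintype.card (ι → Bool) *
      ENNReal.ofReal (a ^ 2 * Real.exp (-(n * a ^ 2 / v)))) ≤ _ :=
    Finset.sum_le_sum fun j _ => sum_coordinateRisk_hypercubeVertex_ge hv hest a j
  rw [Finset.sum_comm] at h1
  have h2 := h1.trans (Finset.sum_le_sum fun s _ => hM (hypercubeVertex a s))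
  rw [Finset.sum_const, Finset.sum_const, nsmul_eq_mul, nsmul_eq_mul, Finset.card_univ,
    Finset.card_univ, mul_left_comm] at h2
  exact (ENNReal.mul_le_mul_iff_right (by simp) (ENNReal.natCast_ne_top _)).1 h2

theorem corollary5 (d n : ℕ) (hd : 2 ≤ d) (hn : 1 ≤ n) (σ : ℝ) (hσ : 0 < σ) :
    ENNReal.ofReal
        (((d : ℝ) - 1) ^ 2 * Real.log 2 / (4 * (d : ℝ) ^ 2) * (σ ^ 2 * (d : ℝ) / (n : ℝ))) ≤
      minimaxRiskIID (normalLocationFamily d σ) (meanParameter d) (fun t => t ^ 2)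
        (fun a b => nndist a b) n := by
  unfold minimaxRiskIID
  refine le_iInf₂ fun est hest => ?_
  set v : ℝ≥0 := ⟨σ ^ 2, sq_nonneg σ⟩ with hvdef
  have hvσ : (v : ℝ) = σ ^ 2 := rfl
  have hv : v ≠ 0 := by
    rw [← NNReal.coe_ne_zero, hvσ]
    positivity
  have hn0 : (0 : ℝ) < n := by exact_mod_cast hn
  have hd0 : (2 : ℝ) ≤ d := by exact_mod_cast hd
  -- This half-side maximises `a² exp (-n a² / σ²)`.
  have hrisk := hypercube_risk_lower_bound hv hest (σ / √n) _ fun θ => by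
    let P : ProbabilityMeasure (EuclideanSpace ℝ (Fin d)) :=
      ⟨multivariateGaussian θ (σ ^ 2 • (1 : Matrix (Fin d) (Fin d) ℝ)), inferInstance⟩
    have hP : P ∈ normalLocationFamily d σ := ⟨θ, rfl⟩
    refine le_trans (le_of_eq ?_) (le_iSup₂ (f := fun P _ =>
      estimatorRisk (meanParameter d) (fun t => t ^ 2) (fun a b => nndist a b) n est P) P hP)
    have hmean : meanParameter d P = θ := integral_id_multivariateGaussian
    unfold estimatorRisk coordinateRisk
    rw [← lintegral_finsetSum _ fun j _ => by fun_prop, hmean]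
    refine lintegral_congr fun x => ?_
    rw [← ENNReal.ofReal_sum_of_nonneg fun j _ => sq_nonneg _, ← ENNReal.ofReal_coe_nnreal]
    congr 1
    push_cast
    rw [EuclideanSpace.dist_eq, Real.sq_sqrt (by positivity)]
    simp [Real.dist_eq]
  refine le_trans ?_ hrisk
  rw [Fintype.card_fin, ← ENNReal.ofReal_natCast, ← ENNReal.ofReal_mul (by positivity)]
  refine ENNReal.ofReal_le_ofReal ?_
  have ha : (σ / √n) ^ 2 = σ ^ 2 / n := by rw [div_pow, Real.sq_sqrt hn0.le]
  have he : -(n * (σ ^ 2 / n) / (v : ℝ)) = -1 := by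
    rw [hvσ]
    field_simp
  rw [ha, he]
  have hlog : Real.log 2 ≤ 1 := by linarith [Real.log_two_lt_d9]
  have hexp : 1 / 4 ≤ Real.exp (-1) := by
    rw [Real.exp_neg, ← one_div]
    exact one_div_le_one_div_of_le (Real.exp_pos 1) (by linarith [Real.exp_one_lt_d9])
  -- The stated constant is below `1/4`, hence below `e⁻¹`.
  have hconst : ((d : ℝ) - 1) ^ 2 * Real.log 2 / (4 * (d : ℝ) ^ 2) ≤ 1 / 4 := by
    rw [div_le_div_iff₀ (by positivity) (by norm_num)]
    nlinarith [mul_le_mul_of_nonneg_left hlog (sq_nonneg ((d : ℝ) - 1))]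
  calc _ ≤ Real.exp (-1) * (σ ^ 2 * (d : ℝ) / (n : ℝ)) :=
        mul_le_mul_of_nonneg_right (hconst.trans hexp) (by positivity)
    _ = _ := by ring
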